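/- Let $A_0\in\mathbb C^{n\times n}$ be unitary and let $I_1,\dots,I_M$ be pairwise disjoint sets with union $\{1,\dots,n\}$. For $1\le k\le M$ let $B_k\in\mathbb C^{|I_k|\times n}$ be the block formed by the rows of $A_0$ with index in $I_k$. Let $\pi=(\pi_1,\dots,\pi_M)$ be a probability distribution on $\{1,\dots,M\}$. For $S\subset\{1,\dots,n\}$ let $P_S$ be the diagonal matrix with diagonal entries $1$ at the indices in $S$ and $0$ elsewhere, put $B_{k,S}=B_kP_S$, and define $$\Theta(S,\pi)=\max_{1\le k\le M}\frac1{\pi_k}\|B_k^*B_{k,S}\|_{\infty\to\infty},\qquad \Upsilon(S,\pi)=\max_{1\le i\le n}\ \sup_{v\in\mathbb C^n,\ \|v\|_\infty\le1}\ \sum_{k=1}^M\frac1{\pi_k}\bigl|e_i^*B_k^*B_{k,S}v\bigr|^2,$$ $$\Gamma(S,\pi)=\max\bigl(\Upsilon(S,\pi),\Theta(S,\pi)\bigr)\in[0,\infty],$$ where $\|G\|_{\infty\to\infty}=\sup_{\|v\|_\infty\le1}\|Gv\|_\infty$, $e_i$ is the $i$-th canonical basis vector, and $\frac{0}{0}=0$,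 $\frac{a}{0}=\infty$ for $a>0$. Let $K_1,\dots,K_m$ be i.i.d. random indices with $\mathbb P(K_\ell=k)=\pi_k$, and let $$A=\frac1{\sqrt m}\Bigl(\frac1{\sqrt{\pi_{K_\ell}}}B_{K_\ell}\Bigr)_{1\le\ell\le m}$$ be the random matrix obtained by stacking the drawn, renormalized blocks. Theorem. Let $S\subset\{1,\dots,n\}$ have cardinality $s\ge16$, let $x\in\mathbb C^n$ satisfy $x_i=0$ for all $i\notin S$, and let $\varepsilon\in(0,1)$. Suppose that $\Gamma(S,\pi)\ge1$ and $$m\ \ge\ 73\,\Gamma(S,\pi)\,\ln(64s)\Bigl(\ln\Bigl(\frac{9n}{\varepsilon}\Bigr)+\ln\ln(64s)\Bigr).$$ Then, with probability larger than $1-\varepsilon$, $x$ is the unique solution of $$\min_{z\in\mathbb C^n,\ Az=Ax}\|z\|_1 .$$ -/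

import Mathlib

open MeasureTheory ProbabilityTheory
open scoped ENNReal Matrix

noncomputable section

namespace BlockCS

/-- The projection matrix `P_S`: diagonal, with entry `1` at `j ∈ S` and `0` elsewhere. -/
def proj {n : ℕ} (S : Finset (Fin n)) : Matrix (Fin n) (Fin n) ℂ :=
  Matrix.diagonal fun j => if j ∈ S then 1 else 0

/-- The block `B_k`: the rows of `A₀` whose index lies in `I k`. -/
def block {n M : ℕ} (A₀ : Matrix (Fin n) (Fin n) ℂ) (I : Fin M → Finset (Fin n)) (k : Fin M) :
    Matrix (I k) (Fin n) ℂ :=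
  A₀.submatrix (fun i => (i : Fin n)) id

/-- The matrix `B_k^* B_{k,S}`, where `B_{k,S} = B_k P_S`. -/
def blockGram {n M : ℕ} (A₀ : Matrix (Fin n) (Fin n) ℂ) (I : Fin M → Finset (Fin n))
    (S : Finset (Fin n)) (k : Fin M) : Matrix (Fin n) (Fin n) ℂ :=
  (block A₀ I k)ᴴ * (block A₀ I k * proj S)

/-- The operator norm `‖G‖_{∞ → ∞} = sup_{‖v‖_∞ ≤ 1} ‖G v‖_∞`, with values in `[0, ∞]`
(the norm on `Fin n → ℂ` is the sup norm). -/
def infNorm {n : ℕ} (G : Matrix (Fin n) (Fin n) ℂ) : ℝ≥0∞ :=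
  ⨆ (v : Fin n → ℂ) (_ : ‖v‖ ≤ 1), ‖G *ᵥ v‖ₑ

/-- `Θ(S, π)`, with values in `[0, ∞]`. Division in `ℝ≥0∞` obeys `a / 0 = ∞` for `a ≠ 0` and
`0 / 0 = 0`, so a block that is never drawn is harmless exactly when it does not see `S`. -/
def Theta {n M : ℕ} (A₀ : Matrix (Fin n) (Fin n) ℂ) (I : Fin M → Finset (Fin n))
    (S : Finset (Fin n)) (π : Fin M → ℝ) : ℝ≥0∞ :=
  ⨆ k : Fin M, infNorm (blockGram A₀ I S k) / ENNReal.ofReal (π k)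

/-- `Υ(S, π)`, with values in `[0, ∞]`. -/
def Upsilon {n M : ℕ} (A₀ : Matrix (Fin n) (Fin n) ℂ) (I : Fin M → Finset (Fin n))
    (S : Finset (Fin n)) (π : Fin M → ℝ) : ℝ≥0∞ :=
  ⨆ (i : Fin n) (v : Fin n → ℂ) (_ : ‖v‖ ≤ 1),
    ∑ k : Fin M, ‖(blockGram A₀ I S k *ᵥ v) i‖ₑ ^ 2 / ENNReal.ofReal (π k)

/-- `Γ(S, π) = max (Υ(S, π)) (Θ(S, π))`. -/
def Gamma {n M : ℕ} (A₀ : Matrix (Fin n) (Fin n) ℂ) (I : Fin M → Finset (Fin n))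
    (S : Finset (Fin n)) (π : Fin M → ℝ) : ℝ≥0∞ :=
  max (Upsilon A₀ I S π) (Theta A₀ I S π)

/-- The sensing matrix for the draw `κ 0, …, κ (m - 1)`: the blocks `B_{κ ℓ} / √(π_{κ ℓ})`
stacked on top of each other and divided by `√m`. Rows are indexed by pairs `(ℓ, i)` with
`i ∈ I (κ ℓ)`. -/
def sensingMatrix {n M m : ℕ} (A₀ : Matrix (Fin n) (Fin n) ℂ) (I : Fin M → Finset (Fin n))
    (π : Fin M → ℝ) (κ : Fin m → Fin M) : Matrix (Σ ℓ : Fin m, I (κ ℓ)) (Fin n) ℂ :=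
  fun p j => ((1 / √(m : ℝ) * (1 / √(π (κ p.1))) : ℝ) : ℂ) * block A₀ I (κ p.1) p.2 j

/-- The `ℓ¹` norm on `ℂⁿ`. -/
def l1Norm {n : ℕ} (z : Fin n → ℂ) : ℝ := ∑ i, ‖z i‖

/-- `z` solves `min ‖z‖₁` subject to `A z = y`. -/
def IsL1Minimizer {n : ℕ} {ι : Type*} (A : Matrix ι (Fin n) ℂ) (y : ι → ℂ)
    (z : Fin n → ℂ) : Prop :=
  A *ᵥ z = y ∧ ∀ w : Fin n → ℂ, A *ᵥ w = y → l1Norm z ≤ l1Norm w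

/-- `x` is the unique solution of `min ‖z‖₁` subject to `A z = y`. -/
def IsUniqueL1Minimizer {n : ℕ} {ι : Type*} (A : Matrix ι (Fin n) ℂ) (y : ι → ℂ)
    (x : Fin n → ℂ) : Prop :=
  IsL1Minimizer A y x ∧ ∀ z : Fin n → ℂ, IsL1Minimizer A y z → z = x

end BlockCS

end

/-! The proof is a golfing argument run entirely in the sup norm, so scalar Bernstein bounds
suffice. The matrices `π_k⁻¹ B_k^* B_k P_S` average to `P_S`, since `A₀` is unitary and the blocks
partition its rows. `Θ` bounds them and `Υ` bounds the variance of each output coordinate; this is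
`isSampling_sampleGram`.

Cut the draws into `L` disjoint groups of size `p`. For a vector `v` supported in `S`, subtract its
empirical image over one group, restrict what is left to `S`, and continue with the next group. As
each iterate is independent of the next group, `mass_residual_le` shows that every coordinate of the
residual, inside and outside `S`, is likely to be at most `0.48` times the sup norm of the iterate.

If `A h = 0`, then `h` is orthogonal to everything subtracted, so telescoping bounds `|⟨h, v⟩|` by
`0.48^L ‖h_S‖₁ + (12/13) ‖h_{Sᶜ}‖₁` when `‖v‖_∞ ≤ 1` (`norm_star_dotProduct_le`). The scheme is run
from the sign of `x` and from each basis vector in `S`, all on the same draws. The basis vectors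
bound each `|h_i|`, hence `‖h_S‖₁` by a multiple of `s ‖h_{Sᶜ}‖₁`, which takes the place of a local
isometry property. The factor `0.48^L ≤ 1/(64s)` absorbs the loss of `s`, so the sign vector gives
`|⟨h, sgn x⟩| < ‖h_{Sᶜ}‖₁` unless `h = 0`. Hence `‖x + h‖₁ > ‖x‖₁` (`l1Norm_lt_l1Norm_add`). -/

namespace BlockCS

/-! ### Independent draws as finite weighted sums, and Bernstein's inequality. -/

section ProductWeight

variable {ι : Type*} [Fintype ι] {M : ℕ}

/-- The probability of the draw `κ` when its entries are independent with law `π`. -/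
noncomputable def weight (π : Fin M → ℝ) (κ : ι → Fin M) : ℝ := ∏ i, π (κ i)

lemma weight_nonneg {π : Fin M → ℝ} (hπ : π ∈ stdSimplex ℝ (Fin M)) (κ : ι → Fin M) :
    0 ≤ weight π κ :=
  Finset.prod_nonneg fun i _ => hπ.1 (κ i)

variable [DecidableEq ι]

open Classical in
/-- The probability of the event `E` when the entries of `κ` are independent with law `π`. -/
noncomputable def mass (π : Fin M → ℝ) (E : (ι → Fin M) → Prop) : ℝ :=
  ∑ κ, if E κ then weight π κ else 0

lemma sum_prod_comp (f : Fin M → ℝ) :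
    ∑ κ : ι → Fin M, ∏ i, f (κ i) = (∑ k, f k) ^ Fintype.card ι := by
  have h := Finset.prod_univ_sum (fun _ : ι => (Finset.univ : Finset (Fin M))) (fun _ k => f k)
  rw [Fintype.piFinset_univ] at h
  rw [← h, Finset.prod_const, Finset.card_univ]

lemma sum_weight {π : Fin M → ℝ} (hπ : π ∈ stdSimplex ℝ (Fin M)) :
    ∑ κ : ι → Fin M, weight π κ = 1 := by
  simp only [weight]
  rw [sum_prod_comp, hπ.2, one_pow]

lemma mass_add_mass_not {π : Fin M → ℝ} (hπ : π ∈ stdSimplex ℝ (Fin M))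
    (E : (ι → Fin M) → Prop) : mass π E + mass π (fun κ => ¬ E κ) = 1 := by
  rw [← sum_weight (ι := ι) hπ, mass, mass, ← Finset.sum_add_distrib]
  refine Finset.sum_congr rfl fun κ _ => ?_
  by_cases h : E κ <;> simp [h]

lemma mass_mono {π : Fin M → ℝ} (hπ : π ∈ stdSimplex ℝ (Fin M)) {E F : (ι → Fin M) → Prop}
    (h : ∀ κ, E κ → F κ) : mass π E ≤ mass π F := by
  refine Finset.sum_le_sum fun κ _ => ?_
  have := weight_nonneg hπ κ
  by_cases hE : E κ
  · simp [hE, h κ hE]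
  · by_cases hF : F κ <;> simp [hE, hF, this]

lemma mass_exists_le {π : Fin M → ℝ} (hπ : π ∈ stdSimplex ℝ (Fin M)) {α : Type*} (T : Finset α)
    (E : α → (ι → Fin M) → Prop) {δ : ℝ} (h : ∀ a ∈ T, mass π (E a) ≤ δ) :
    mass π (fun κ => ∃ a ∈ T, E a κ) ≤ T.card * δ := by
  classical
  calc mass π (fun κ => ∃ a ∈ T, E a κ) ≤ ∑ a ∈ T, mass π (E a) := by
        simp only [mass]
        rw [Finset.sum_comm]
        refine Finset.sum_le_sum fun κ _ => ?_
        have hw := weight_nonneg hπ κ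
        have h0 : ∀ a ∈ T, 0 ≤ if E a κ then weight π κ else 0 := fun a _ => by
          split_ifs <;> simp [hw]
        split_ifs with hE
        · obtain ⟨a, ha, hEa⟩ := hE
          refine le_trans ?_ (Finset.single_le_sum h0 ha)
          simp [hEa]
        · exact Finset.sum_nonneg h0
    _ ≤ ∑ a ∈ T, δ := Finset.sum_le_sum h
    _ = T.card * δ := by simp

/-- Integrating out the coordinates in `B` from a product whose factors depend on these
coordinates only through one entry each. -/
lemma sum_weight_mul_prod_le {π : Fin M → ℝ} (hπ : π ∈ stdSimplex ℝ (Fin M))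
    (B : Finset ι) (e : (ι → Fin M) → Fin M → ℝ) (he : ∀ κ k, 0 ≤ e κ k)
    (hdep : ∀ κ κ', (∀ i, i ∉ B → κ i = κ' i) → e κ = e κ')
    {a : ℝ} (ha : ∀ κ, ∑ k, π k * e κ k ≤ a) :
    ∑ κ, weight π κ * ∏ i ∈ B, e κ (κ i) ≤ a ^ B.card := by
  classical
  -- `k₀` is a filler for the coordinates in `B`: `e` ignores them, so any value gives a reference
  -- draw `κ₀`.
  obtain ⟨k₀⟩ : Nonempty (Fin M) := by
    by_contra h
    rw [not_nonempty_iff] at h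
    simpa using hπ.2
  let Φ := Equiv.piEquivPiSubtypeProd (fun i => i ∈ B) (fun _ : ι => Fin M)
  rw [← Φ.symm.sum_comp, Fintype.sum_prod_type_right]
  have key : ∀ b : {i // i ∉ B} → Fin M,
      ∑ c : {i // i ∈ B} → Fin M, weight π (Φ.symm (c, b)) *
        ∏ i ∈ B, e (Φ.symm (c, b)) (Φ.symm (c, b) i) ≤ weight π b * a ^ B.card := by
    intro b
    have hin : ∀ c (i : {i // i ∈ B}), Φ.symm (c, b) i = c i := fun c i => by
      simp [Φ, Equiv.piEquivPiSubtypeProd]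
    have hout : ∀ c (i : {i // i ∉ B}), Φ.symm (c, b) i = b i := fun c i => by
      simp [Φ, Equiv.piEquivPiSubtypeProd, i.2]
    set κ₀ := Φ.symm (fun _ => k₀, b) with hκ₀
    have hconst : ∀ c, e (Φ.symm (c, b)) = e κ₀ := fun c =>
      hdep _ _ fun i hi => by rw [hout c ⟨i, hi⟩, hκ₀, hout _ ⟨i, hi⟩]
    have hterm : ∀ c, weight π (Φ.symm (c, b)) *
        ∏ i ∈ B, e (Φ.symm (c, b)) (Φ.symm (c, b) i) =
        weight π b * ∏ i, (π (c i) * e κ₀ (c i)) := by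
      intro c
      have h1 : weight π (Φ.symm (c, b)) = (∏ i, π (c i)) * weight π b := by
        rw [weight, ← Fintype.prod_subtype_mul_prod_subtype (fun i => i ∈ B)]
        simp only [hin, hout, weight]
        congr!
      have h2 : ∏ i ∈ B, e (Φ.symm (c, b)) (Φ.symm (c, b) i) = ∏ i, e κ₀ (c i) := by
        rw [hconst, ← Finset.prod_coe_sort B]
        simp only [hin]
      rw [h1, h2, Finset.prod_mul_distrib]
      ring
    simp only [hterm]
    rw [← Finset.mul_sum, sum_prod_comp (fun k => π k * e κ₀ k), Fintype.card_coe]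
    refine mul_le_mul_of_nonneg_left ?_ (weight_nonneg hπ b)
    exact pow_le_pow_left₀ (Finset.sum_nonneg fun k _ => mul_nonneg (hπ.1 k) (he _ _)) (ha _) _
  refine (Finset.sum_le_sum fun b _ => key b).trans ?_
  rw [← Finset.sum_mul, sum_weight hπ, one_mul]

/-- The third-order Taylor remainder is at most `(2/9)|x|³ ≤ x²/9`, and `1/2 + 1/9 = 11/18`. -/
lemma exp_le_quadratic {x : ℝ} (hx : |x| ≤ 1 / 2) :
    Real.exp x ≤ 1 + x + (11 / 18 : ℝ) * x ^ 2 := by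
  have h := Real.exp_bound (x := x) (by linarith) (n := 3) (by norm_num)
  simp only [Finset.sum_range_succ, Finset.sum_range_zero, Nat.factorial] at h
  norm_num at h
  have h' := (abs_le.1 h).2
  have h3 : |x| ^ 3 ≤ 1 / 2 * x ^ 2 := by
    rw [pow_succ, sq_abs]; nlinarith [sq_nonneg x]
  linarith

/-- Bernstein's inequality at a fixed deviation, for summands that may depend on the draws outside
the block `B` over which one sums. -/
lemma mass_bernstein_le {π : Fin M → ℝ} (hπ : π ∈ stdSimplex ℝ (Fin M)) {g : ℝ} (hg : 0 < g)
    (B : Finset ι) (f : (ι → Fin M) → Fin M → ℝ)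
    (hdep : ∀ κ κ', (∀ i, i ∉ B → κ i = κ' i) → f κ = f κ')
    (hmean : ∀ κ, ∑ k, π k * f κ k = 0) (hbound : ∀ κ k, |f κ k| ≤ 2 * g)
    (hvar : ∀ κ, ∑ k, π k * f κ k ^ 2 ≤ g) :
    mass π (fun κ => (0.339 : ℝ) * B.card < ∑ i ∈ B, f κ (κ i)) ≤
      Real.exp (-(0.0465 * B.card / g)) := by
  classical
  -- The tilt `1/(4g)` brings `|f| ≤ 2g` down to `1/2`; the constant is `(11/18)/16 = 11/288`.
  have hmgf : ∀ κ, ∑ k, π k * Real.exp (f κ k / (4 * g)) ≤ Real.exp (11 / 288 / g) := by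
    intro κ
    calc ∑ k, π k * Real.exp (f κ k / (4 * g))
        ≤ ∑ k, (π k + (1 / (4 * g)) * (π k * f κ k) +
            (11 / 288 / g ^ 2) * (π k * f κ k ^ 2)) := by
          refine Finset.sum_le_sum fun k _ => ?_
          have h1 : |f κ k / (4 * g)| ≤ 1 / 2 := by
            rw [abs_div, abs_of_pos (by positivity : 0 < 4 * g), div_le_iff₀ (by positivity)]
            linarith [hbound κ k]
          refine (mul_le_mul_of_nonneg_left (exp_le_quadratic h1) (hπ.1 k)).trans (le_of_eq ?_)
          field_simp
          ring
      _ = 1 + (11 / 288 / g ^ 2) * ∑ k, π k * f κ k ^ 2 := by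
          rw [Finset.sum_add_distrib, Finset.sum_add_distrib, ← Finset.mul_sum, ← Finset.mul_sum,
            hmean, hπ.2, mul_zero, add_zero]
      _ ≤ 1 + (11 / 288 / g ^ 2) * g := by gcongr; exact hvar κ
      _ = 11 / 288 / g + 1 := by field_simp; ring
      _ ≤ _ := Real.add_one_le_exp _
  have hmain := sum_weight_mul_prod_le hπ B (fun κ k => Real.exp (f κ k / (4 * g)))
    (fun κ k => (Real.exp_pos _).le)
    (fun κ κ' h => by simp only [hdep κ κ' h]) hmgf
  have hpow : Real.exp (11 / 288 / g) ^ B.card = Real.exp (B.card * (11 / 288 / g)) := by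
    rw [← Real.exp_nat_mul]
  rw [hpow] at hmain
  have hle : mass π (fun κ => (0.339 : ℝ) * B.card < ∑ i ∈ B, f κ (κ i)) ≤
      Real.exp (-(0.339 * B.card / (4 * g))) *
        ∑ κ, weight π κ * ∏ i ∈ B, Real.exp (f κ (κ i) / (4 * g)) := by
    rw [mass, Finset.mul_sum]
    refine Finset.sum_le_sum fun κ _ => ?_
    have hw := weight_nonneg hπ κ
    rw [← Real.exp_sum, ← Finset.sum_div]
    split_ifs with hκ
    · have h1 : (1 : ℝ) ≤ Real.exp (-(0.339 * B.card / (4 * g))) *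
          Real.exp ((∑ i ∈ B, f κ (κ i)) / (4 * g)) := by
        rw [← Real.exp_add]
        refine Real.one_le_exp ?_
        rw [neg_add_eq_sub, ← sub_div]
        exact div_nonneg (by linarith) (by positivity)
      calc weight π κ = weight π κ * 1 := (mul_one _).symm
        _ ≤ weight π κ * _ := mul_le_mul_of_nonneg_left h1 hw
        _ = _ := by ring
    · positivity
  refine hle.trans ((mul_le_mul_of_nonneg_left hmain (Real.exp_pos _).le).trans ?_)
  rw [← Real.exp_add]
  refine Real.exp_le_exp.2 ?_
  -- The rate comes from `0.339/4 - 11/288 > 0.0465`.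
  have hB : (0 : ℝ) ≤ B.card / g := by positivity
  have e1 : (0.339 : ℝ) * B.card / (4 * g) = 0.08475 * (B.card / g) := by
    field_simp; norm_num; ring
  have e2 : (B.card : ℝ) * (11 / 288 / g) = 11 / 288 * (B.card / g) := by field_simp
  have e3 : (0.0465 : ℝ) * B.card / g = 0.0465 * (B.card / g) := by ring
  rw [e1, e2, e3]
  nlinarith

/-- The law of independent draws from `π`, as a finite sum. -/
lemma measureReal_eq_mass {Ω : Type*} [MeasurableSpace Ω] (P : Measure Ω) [IsProbabilityMeasure P]
    {π : Fin M → ℝ} (K : ι → Ω → Fin M) (hK_meas : ∀ ℓ, Measurable (K ℓ))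
    (hK_indep : iIndepFun K P) (hK_law : ∀ ℓ k, P.real {ω | K ℓ ω = k} = π k)
    (E : (ι → Fin M) → Prop) : P.real {ω | E fun ℓ => K ℓ ω} = mass π E := by
  classical
  have hatom : ∀ κ : ι → Fin M, P.real {ω | (fun ℓ => K ℓ ω) = κ} = weight π κ := by
    intro κ
    have h := hK_indep.measure_inter_preimage_eq_mul Finset.univ (sets := fun ℓ => {κ ℓ})
      (fun ℓ _ => MeasurableSet.singleton _)
    have hset : {ω | (fun ℓ => K ℓ ω) = κ} = ⋂ ℓ ∈ Finset.univ, K ℓ ⁻¹' {κ ℓ} := by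
      ext ω; simp [funext_iff]
    rw [hset, measureReal_def, h, ENNReal.toReal_prod]
    exact Finset.prod_congr rfl fun ℓ _ => hK_law ℓ (κ ℓ)
  have hmeas : ∀ κ : ι → Fin M, MeasurableSet {ω | (fun ℓ => K ℓ ω) = κ} := fun κ =>
    (measurable_pi_iff.2 hK_meas) (MeasurableSet.singleton κ)
  have hset : {ω | E fun ℓ => K ℓ ω} =
      ⋃ κ ∈ Finset.univ.filter E, {ω | (fun ℓ => K ℓ ω) = κ} := by
    ext ω; simp
  rw [hset, measureReal_biUnion_finset _ (fun κ _ => hmeas κ), mass, Finset.sum_filter]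
  · exact Finset.sum_congr rfl fun κ _ => by rw [hatom]
  · intro κ _ κ' _ hne
    refine Set.disjoint_left.2 fun ω h h' => hne ?_
    exact h.symm.trans h'

end ProductWeight

end BlockCS

namespace BlockCS

/-! ### One golfing step, its iteration, and the resulting approximate dual certificate. -/

section Golfing

/-- A random matrix `G k`, with `k` drawn from `π`, that acts in the mean as the identity on the
vectors supported in `S`, with bound and variance at most `g` in the sup norm. -/
structure IsSampling {n M : ℕ} (G : Fin M → Matrix (Fin n) (Fin n) ℂ) (π : Fin M → ℝ)
    (S : Finset (Fin n)) (g : ℝ) : Prop where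
  simplex : π ∈ stdSimplex ℝ (Fin M)
  one_le : 1 ≤ g
  mean : ∀ v : Fin n → ℂ, (∀ i, i ∉ S → v i = 0) → ∀ i, ∑ k, (π k : ℂ) * (G k *ᵥ v) i = v i
  bound : ∀ k v i, ‖(G k *ᵥ v) i‖ ≤ g * ‖v‖
  var : ∀ v i, ∑ k, π k * ‖(G k *ᵥ v) i‖ ^ 2 ≤ g * ‖v‖ ^ 2

variable {n M : ℕ} {G : Fin M → Matrix (Fin n) (Fin n) ℂ} {π : Fin M → ℝ}
  {S : Finset (Fin n)} {g : ℝ}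

/-- What is left of `v` after subtracting its empirical image over the draws in `B`. -/
noncomputable def residual {ι : Type*} (G : Fin M → Matrix (Fin n) (Fin n) ℂ) (B : Finset ι)
    (κ : ι → Fin M) (v : Fin n → ℂ) : Fin n → ℂ :=
  v - (B.card : ℂ)⁻¹ • ∑ ℓ ∈ B, G (κ ℓ) *ᵥ v

lemma card_mul_residual_apply {ι : Type*} {B : Finset ι} (hB : B.Nonempty) (κ : ι → Fin M)
    (v : Fin n → ℂ) (i : Fin n) :
    (B.card : ℂ) * residual G B κ v i = -∑ ℓ ∈ B, ((G (κ ℓ) *ᵥ v) i - v i) := by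
  have h : (B.card : ℂ) ≠ 0 := by exact_mod_cast hB.card_pos.ne'
  simp only [residual, Pi.sub_apply, Pi.smul_apply, Finset.sum_apply, smul_eq_mul,
    Finset.sum_sub_distrib, Finset.sum_const, nsmul_eq_mul]
  field_simp
  ring

/-- The real and imaginary part of a number, with both signs, are the real parts of its products
with these units. -/
noncomputable def phase : Fin 4 → ℂ := ![1, -1, Complex.I, -Complex.I]

lemma norm_phase (c : Fin 4) : ‖phase c‖ = 1 := by
  fin_cases c <;> simp [phase]

/-- The four phases confine `w` to a square of half-side `0.339 a`, whose corners have modulus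
`0.339 √2 a < 0.48 a`. -/
lemma norm_le_of_phase_le {w : ℂ} {a : ℝ} (h : ∀ c, (phase c * w).re ≤ 0.339 * a) :
    ‖w‖ ≤ 0.48 * a := by
  have h0 := h 0
  have h1 := h 1
  have h2 := h 2
  have h3 := h 3
  simp [phase] at h0 h1 h2 h3
  have ha : 0 ≤ a := by norm_num at *; linarith
  refine le_of_sq_le_sq ?_ (by positivity)
  rw [← Complex.normSq_eq_norm_sq, Complex.normSq_apply]
  norm_num at *
  nlinarith [mul_nonneg (sub_nonneg.2 h0) (by linarith : 0 ≤ 339 / 1000 * a + w.re),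
    mul_nonneg (by linarith : 0 ≤ 339 / 1000 * a - w.im) (by linarith : 0 ≤ 339 / 1000 * a + w.im)]

/-- Bernstein applies to each of the four phases of the centred summands `(G k u - u)_i`. The vector
`u` may be random as long as it does not look at the draws in `B`; its support in `S` is what makes
the summands centred. -/
lemma IsSampling.mass_residual_le {ι : Type*} [Fintype ι] [DecidableEq ι]
    (hG : IsSampling G π S g) {B : Finset ι} (hB : B.Nonempty)
    (u : (ι → Fin M) → Fin n → ℂ) (hdep : ∀ κ κ', (∀ ℓ, ℓ ∉ B → κ ℓ = κ' ℓ) → u κ = u κ')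
    (hsupp : ∀ κ i, i ∉ S → u κ i = 0) (i : Fin n) :
    mass π (fun κ => 0.48 * ‖u κ‖ < ‖residual G B κ (u κ) i‖) ≤
      4 * Real.exp (-(0.0465 * B.card / g)) := by
  have hg : 0 < g := one_pos.trans_le hG.one_le
  let d : (ι → Fin M) → Fin M → ℂ := fun κ k => (G k *ᵥ u κ) i - u κ i
  -- Normalizing by `‖u κ‖` turns the relative deviation into a fixed one. If `u κ = 0` the quotient
  -- is `0`, so the Bernstein hypotheses still hold.
  let F : Fin 4 → (ι → Fin M) → Fin M → ℝ := fun c κ k => (phase c * d κ k).re / ‖u κ‖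
  have habs : ∀ c κ k, |F c κ k| ≤ ‖d κ k‖ / ‖u κ‖ := by
    intro c κ k
    rw [abs_div, abs_norm]
    gcongr
    refine (Complex.abs_re_le_norm _).trans_eq ?_
    rw [norm_mul, norm_phase, one_mul]
  have hmean : ∀ κ, ∑ k, (π k : ℂ) * d κ k = 0 := by
    intro κ
    simp only [d, mul_sub, Finset.sum_sub_distrib, hG.mean _ (hsupp κ), ← Finset.sum_mul]
    rw [← Complex.ofReal_sum, hG.simplex.2]
    simp
  have hpart : ∀ c, mass π (fun κ => (0.339 : ℝ) * B.card < ∑ ℓ ∈ B, F c κ (κ ℓ)) ≤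
      Real.exp (-(0.0465 * B.card / g)) := by
    intro c
    refine mass_bernstein_le hG.simplex hg B (F c) ?_ ?_ ?_ ?_
    · intro κ κ' h
      simp only [F, d, hdep κ κ' h]
    · intro κ
      have : ∑ k, π k * F c κ k = (phase c * ∑ k, (π k : ℂ) * d κ k).re / ‖u κ‖ := by
        rw [Finset.mul_sum, Complex.re_sum, Finset.sum_div]
        refine Finset.sum_congr rfl fun k _ => ?_
        rw [mul_left_comm, Complex.re_ofReal_mul, mul_div_assoc]
      rw [this, hmean]
      simp
    · intro κ k
      refine (habs c κ k).trans (div_le_of_le_mul₀ (norm_nonneg _) (by positivity) ?_)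
      have h1 := hG.bound k (u κ) i
      have h2 := norm_le_pi_norm (u κ) i
      have h3 : ‖d κ k‖ ≤ _ := norm_sub_le ((G k *ᵥ u κ) i) (u κ i)
      nlinarith [norm_nonneg (u κ), hG.one_le]
    · intro κ
      have hsq : ∑ k, π k * ‖d κ k‖ ^ 2 ≤ g * ‖u κ‖ ^ 2 := by
        -- Variance is second moment minus squared mean, so centring does not increase the bound
        -- `g`.
        have e : ∑ k, π k * ‖d κ k‖ ^ 2 =
            ∑ k, π k * ‖(G k *ᵥ u κ) i‖ ^ 2 - ‖u κ i‖ ^ 2 := by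
          have hcross : ∑ k, π k * ((G k *ᵥ u κ) i * (starRingEnd ℂ) (u κ i)).re =
              ‖u κ i‖ ^ 2 := by
            have : ∑ k, π k * ((G k *ᵥ u κ) i * (starRingEnd ℂ) (u κ i)).re =
                ((∑ k, (π k : ℂ) * (G k *ᵥ u κ) i) * (starRingEnd ℂ) (u κ i)).re := by
              rw [Finset.sum_mul, Complex.re_sum]
              refine Finset.sum_congr rfl fun k _ => ?_
              rw [mul_assoc, Complex.re_ofReal_mul]
            rw [this, hG.mean _ (hsupp κ), Complex.mul_conj, Complex.ofReal_re,
              Complex.normSq_eq_norm_sq]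
          have hterm : ∀ k, π k * ‖d κ k‖ ^ 2 = π k * ‖(G k *ᵥ u κ) i‖ ^ 2 +
              π k * ‖u κ i‖ ^ 2 -
              2 * (π k * ((G k *ᵥ u κ) i * (starRingEnd ℂ) (u κ i)).re) := by
            intro k
            simp only [d, ← Complex.normSq_eq_norm_sq, Complex.normSq_sub]
            ring
          simp only [hterm]
          rw [Finset.sum_sub_distrib, Finset.sum_add_distrib, ← Finset.mul_sum, hcross,
            ← Finset.sum_mul, hG.simplex.2]
          ring
        rw [e]
        have := hG.var (u κ) i
        nlinarith [sq_nonneg ‖u κ i‖]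
      calc ∑ k, π k * F c κ k ^ 2 ≤ ∑ k, (π k * ‖d κ k‖ ^ 2) / ‖u κ‖ ^ 2 := by
            refine Finset.sum_le_sum fun k _ => ?_
            rw [mul_div_assoc, ← div_pow, ← sq_abs (F c κ k)]
            exact mul_le_mul_of_nonneg_left (pow_le_pow_left₀ (abs_nonneg _) (habs c κ k) 2)
              (hG.simplex.1 k)
        _ ≤ g := by
            rw [← Finset.sum_div]
            exact div_le_of_le_mul₀ (by positivity) hg.le hsq
  have hunion := mass_exists_le hG.simplex Finset.univ
    (fun c κ => (0.339 : ℝ) * B.card < ∑ ℓ ∈ B, F c κ (κ ℓ)) fun c _ => hpart c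
  rw [Finset.card_univ, Fintype.card_fin, Nat.cast_ofNat] at hunion
  refine (mass_mono hG.simplex fun κ hκ => ?_).trans hunion
  contrapose! hκ
  have hcard : (0 : ℝ) < B.card := by exact_mod_cast hB.card_pos
  have hnorm : (B.card : ℝ) * ‖residual G B κ (u κ) i‖ = ‖∑ ℓ ∈ B, d κ (κ ℓ)‖ := by
    rw [← norm_neg (∑ ℓ ∈ B, d κ (κ ℓ)), ← card_mul_residual_apply hB, norm_mul,
      Complex.norm_natCast]
  refine le_of_mul_le_mul_left ?_ hcard
  rw [hnorm, mul_left_comm]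
  refine norm_le_of_phase_le fun c => ?_
  have hc := hκ c (Finset.mem_univ c)
  simp only [F] at hc
  rw [← Finset.sum_div, ← Complex.re_sum, ← Finset.mul_sum] at hc
  rcases (norm_nonneg (u κ)).eq_or_lt with h0 | h0
  · have hu : u κ = 0 := norm_eq_zero.1 h0.symm
    simp [d, hu]
  · rw [div_le_iff₀ h0] at hc
    linarith

variable {m : ℕ}

/-- The `j`-th group of `p` consecutive draws. -/
def chunk (m p j : ℕ) : Finset (Fin m) := Finset.univ.filter fun ℓ => (ℓ : ℕ) / p = j

lemma card_chunk {p j : ℕ} (hp : 0 < p) (h : (j + 1) * p ≤ m) : (chunk m p j).card = p := by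
  have hmap : (chunk m p j).map Fin.valEmbedding = Finset.Ico (j * p) ((j + 1) * p) := by
    ext a
    simp only [chunk, Finset.mem_map, Finset.mem_filter, Finset.mem_univ, true_and,
      Fin.valEmbedding_apply, Finset.mem_Ico]
    constructor
    · rintro ⟨ℓ, rfl, rfl⟩
      exact ⟨Nat.div_mul_le_self _ _, by
        rw [mul_comm]; exact Nat.lt_mul_div_succ _ hp⟩
    · rintro ⟨h1, h2⟩
      exact ⟨⟨a, h2.trans_le h⟩, Nat.div_eq_of_lt_le h1 h2, rfl⟩
  rw [← Finset.card_map Fin.valEmbedding, hmap, Nat.card_Ico, add_mul, one_mul]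
  omega

/-- The golfing iteration: the `j`-th step replaces the current vector by the restriction to `S` of
its residual over the `j`-th group of draws. -/
noncomputable def golf (G : Fin M → Matrix (Fin n) (Fin n) ℂ) (S : Finset (Fin n)) (p : ℕ)
    (κ : Fin m → Fin M) (v : Fin n → ℂ) : ℕ → Fin n → ℂ
  | 0 => v
  | j + 1 => fun i => if i ∈ S then residual G (chunk m p j) κ (golf G S p κ v j) i else 0

lemma golf_apply_of_notMem {v : Fin n → ℂ} (hv : ∀ i, i ∉ S → v i = 0) (p : ℕ)
    (κ : Fin m → Fin M) (j : ℕ) : ∀ i, i ∉ S → golf G S p κ v j i = 0 := by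
  intro i hi
  cases j with
  | zero => exact hv i hi
  | succ j => simp [golf, hi]

/-- This is the independence behind golfing: the `j`-th iterate reads only earlier groups, so it is
fixed while the `j`-th group is averaged out. -/
lemma golf_congr {p : ℕ} {κ κ' : Fin m → Fin M} (v : Fin n → ℂ) (j : ℕ)
    (h : ∀ ℓ : Fin m, (ℓ : ℕ) / p < j → κ ℓ = κ' ℓ) : golf G S p κ v j = golf G S p κ' v j := by
  induction j with
  | zero => rfl
  | succ j ih =>
    have ih' := ih fun ℓ hℓ => h ℓ (hℓ.trans (Nat.lt_succ_self j))
    have hr : residual G (chunk m p j) κ = residual G (chunk m p j) κ' := by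
      funext w
      simp only [residual]
      congr 2
      refine Finset.sum_congr rfl fun ℓ hℓ => ?_
      rw [h ℓ]
      rw [chunk, Finset.mem_filter] at hℓ
      omega
    simp only [golf, ih', hr]

/-- The first `L` golfing steps from `v` shrink every coordinate of the residual. -/
def GolfContracts (G : Fin M → Matrix (Fin n) (Fin n) ℂ) (S : Finset (Fin n)) (p L : ℕ)
    (κ : Fin m → Fin M) (v : Fin n → ℂ) : Prop :=
  ∀ j < L, ∀ i, ‖residual G (chunk m p j) κ (golf G S p κ v j) i‖ ≤ 0.48 * ‖golf G S p κ v j‖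

/-- A union bound over starting vectors, steps and coordinates; no independence between these events
is needed. -/
lemma IsSampling.mass_not_golfContracts_le (hG : IsSampling G π S g) {p L : ℕ} (hp : 0 < p)
    (hm : L * p ≤ m) (V : Finset (Fin n → ℂ)) (hV : ∀ v ∈ V, ∀ i, i ∉ S → v i = 0) :
    mass π (fun κ : Fin m → Fin M => ∃ v ∈ V, ¬ GolfContracts G S p L κ v) ≤
      V.card * (L * (n * (4 * Real.exp (-(0.0465 * p / g))))) := by
  refine mass_exists_le hG.simplex V _ fun v hv => ?_
  have hL := mass_exists_le (ι := Fin m) hG.simplex (Finset.range L)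
    (fun j κ => ∃ i ∈ (Finset.univ : Finset (Fin n)), 0.48 * ‖golf G S p κ v j‖ <
      ‖residual G (chunk m p j) κ (golf G S p κ v j) i‖)
    (δ := n * (4 * Real.exp (-(0.0465 * p / g)))) (by
      intro j hj
      rw [Finset.mem_range] at hj
      have hc : (chunk m p j).card = p :=
        card_chunk hp ((Nat.mul_le_mul_right p hj).trans hm)
      have hn := mass_exists_le (ι := Fin m) hG.simplex (Finset.univ : Finset (Fin n))
        (fun i κ => 0.48 * ‖golf G S p κ v j‖ <
          ‖residual G (chunk m p j) κ (golf G S p κ v j) i‖)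
        (δ := 4 * Real.exp (-(0.0465 * p / g))) (by
          intro i _
          have h := hG.mass_residual_le (B := chunk m p j)
            (Finset.card_pos.1 (hc.symm ▸ hp)) (fun κ => golf G S p κ v j)
            (fun κ κ' h => golf_congr v j fun ℓ hℓ => h ℓ (by simp [chunk]; omega))
            (fun κ => golf_apply_of_notMem (hV v hv) p κ j) i
          rwa [hc] at h)
      rwa [Finset.card_univ, Fintype.card_fin] at hn)
  rw [Finset.card_range] at hL
  refine (mass_mono hG.simplex fun κ hκ => ?_).trans hL
  simp only [GolfContracts, not_forall, not_le] at hκ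
  obtain ⟨j, hj, i, hi⟩ := hκ
  exact ⟨j, Finset.mem_range.2 hj, i, Finset.mem_univ i, hi⟩

lemma norm_golf_le {p L : ℕ} {κ : Fin m → Fin M} {v : Fin n → ℂ}
    (h : GolfContracts G S p L κ v) : ∀ j ≤ L, ‖golf G S p κ v j‖ ≤ 0.48 ^ j * ‖v‖ := by
  intro j
  induction j with
  | zero => simp [golf]
  | succ j ih =>
    intro hj
    have hstep : ‖golf G S p κ v (j + 1)‖ ≤ 0.48 * ‖golf G S p κ v j‖ := by
      refine (pi_norm_le_iff_of_nonneg (by positivity)).2 fun i => ?_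
      by_cases hi : i ∈ S
      · simpa [golf, hi] using h j hj i
      · simp only [golf, hi, if_false, norm_zero]
        positivity
    refine hstep.trans ?_
    rw [pow_succ', mul_assoc]
    exact mul_le_mul_of_nonneg_left (ih (Nat.le_of_succ_le hj)) (by norm_num)

/-- Golfing nearly certifies that the vectors orthogonal to the ranges of all drawn matrices are
orthogonal to `v`. -/
lemma norm_star_dotProduct_le {p L : ℕ} {κ : Fin m → Fin M} {v h : Fin n → ℂ}
    (hv : ∀ i, i ∉ S → v i = 0) (hgood : GolfContracts G S p L κ v)
    (hker : ∀ ℓ w, star h ⬝ᵥ (G (κ ℓ) *ᵥ w) = 0) :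
    ‖star h ⬝ᵥ v‖ ≤
      0.48 ^ L * ‖v‖ * ∑ i ∈ S, ‖h i‖ + 12 / 13 * ‖v‖ * ∑ i ∈ Sᶜ, ‖h i‖ := by
  -- Each step loses `0.48^(j+1) ‖v‖` times the mass of `h` off `S`; the geometric series sums to
  -- `0.48/0.52 = 12/13`.
  have hiter : ∀ j ≤ L, ‖star h ⬝ᵥ v‖ ≤ ‖star h ⬝ᵥ golf G S p κ v j‖ +
      12 / 13 * (1 - 0.48 ^ j) * ‖v‖ * ∑ i ∈ Sᶜ, ‖h i‖ := by
    intro j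
    induction j with
    | zero => simp [golf]
    | succ j ih =>
      intro hj
      have hres : star h ⬝ᵥ golf G S p κ v j =
          star h ⬝ᵥ residual G (chunk m p j) κ (golf G S p κ v j) := by
        rw [residual, dotProduct_sub, dotProduct_smul, dotProduct_sum]
        simp [hker]
      have hsplit : star h ⬝ᵥ residual G (chunk m p j) κ (golf G S p κ v j) =
          star h ⬝ᵥ golf G S p κ v (j + 1) +
            ∑ i ∈ Sᶜ, star (h i) * residual G (chunk m p j) κ (golf G S p κ v j) i := by
        simp only [dotProduct, golf, Pi.star_apply]
        rw [← Finset.sum_add_sum_compl S, ← Finset.sum_add_sum_compl S (fun i => star (h i) *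
          if i ∈ S then residual G (chunk m p j) κ (golf G S p κ v j) i else 0)]
        have e1 : ∑ i ∈ S, star (h i) *
            (if i ∈ S then residual G (chunk m p j) κ (golf G S p κ v j) i else 0) =
            ∑ i ∈ S, star (h i) * residual G (chunk m p j) κ (golf G S p κ v j) i :=
          Finset.sum_congr rfl fun i hi => by rw [if_pos hi]
        have e2 : ∑ i ∈ Sᶜ, star (h i) *
            (if i ∈ S then residual G (chunk m p j) κ (golf G S p κ v j) i else 0) = 0 :=
          Finset.sum_eq_zero fun i hi => by rw [if_neg (Finset.mem_compl.1 hi), mul_zero]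
        rw [e1, e2, add_zero]
      have htail : ‖∑ i ∈ Sᶜ, star (h i) * residual G (chunk m p j) κ (golf G S p κ v j) i‖ ≤
          0.48 * (0.48 ^ j * ‖v‖) * ∑ i ∈ Sᶜ, ‖h i‖ := by
        rw [Finset.mul_sum]
        refine norm_sum_le_of_le _ fun i _ => ?_
        rw [norm_mul, norm_star, mul_comm]
        refine mul_le_mul_of_nonneg_right ((hgood j hj i).trans ?_) (norm_nonneg _)
        exact mul_le_mul_of_nonneg_left (norm_golf_le hgood j (Nat.le_of_succ_le hj))
          (by norm_num)
      have h1 := ih (Nat.le_of_succ_le hj)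
      rw [hres, hsplit] at h1
      have h2 := norm_add_le (star h ⬝ᵥ golf G S p κ v (j + 1))
        (∑ i ∈ Sᶜ, star (h i) * residual G (chunk m p j) κ (golf G S p κ v j) i)
      have e : (12 / 13 : ℝ) * (1 - 0.48 ^ (j + 1)) * ‖v‖ * ∑ i ∈ Sᶜ, ‖h i‖ =
          12 / 13 * (1 - 0.48 ^ j) * ‖v‖ * ∑ i ∈ Sᶜ, ‖h i‖ +
            0.48 * (0.48 ^ j * ‖v‖) * ∑ i ∈ Sᶜ, ‖h i‖ := by
        rw [pow_succ]; norm_num; ring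
      linarith
  refine (hiter L le_rfl).trans (add_le_add ?_ ?_)
  · have hS : star h ⬝ᵥ golf G S p κ v L = ∑ i ∈ S, star (h i) * golf G S p κ v L i := by
      rw [dotProduct]
      refine (Finset.sum_subset (Finset.subset_univ S) fun i _ hi => ?_).symm
      rw [golf_apply_of_notMem hv p κ L i hi, mul_zero]
    rw [hS, Finset.mul_sum]
    refine norm_sum_le_of_le _ fun i _ => ?_
    rw [norm_mul, norm_star, mul_comm]
    exact mul_le_mul_of_nonneg_right ((norm_le_pi_norm _ i).trans (norm_golf_le hgood L le_rfl))
      (norm_nonneg _)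
  · have h1 : 0 ≤ ‖v‖ * ∑ i ∈ Sᶜ, ‖h i‖ :=
      mul_nonneg (norm_nonneg v) (Finset.sum_nonneg fun i _ => norm_nonneg _)
    have h2 : (0 : ℝ) ≤ 0.48 ^ L := by positivity
    nlinarith [mul_nonneg h1 h2]

end Golfing

end BlockCS

namespace BlockCS

/-! ### The sampled blocks, and exact recovery from successful golfing. -/

section Recovery

variable {n M m : ℕ} {A₀ : Matrix (Fin n) (Fin n) ℂ} {I : Fin M → Finset (Fin n)}
  {π : Fin M → ℝ} {S : Finset (Fin n)}

/-- The Gram matrix of a drawn and renormalized block; it vanishes if `π k = 0`. -/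
noncomputable def sampleGram (A₀ : Matrix (Fin n) (Fin n) ℂ) (I : Fin M → Finset (Fin n))
    (S : Finset (Fin n)) (π : Fin M → ℝ) (k : Fin M) : Matrix (Fin n) (Fin n) ℂ :=
  ((π k)⁻¹ : ℂ) • blockGram A₀ I S k

lemma sampleGram_mulVec (k : Fin M) (v : Fin n → ℂ) :
    sampleGram A₀ I S π k *ᵥ v = ((π k)⁻¹ : ℂ) • (blockGram A₀ I S k *ᵥ v) := by
  rw [sampleGram, Matrix.smul_mulVec]

lemma norm_blockGram_mulVec_le (hπ : π ∈ stdSimplex ℝ (Fin M)) (hΓ : 1 ≤ Gamma A₀ I S π)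
    (hfin : Gamma A₀ I S π ≠ ∞) (k : Fin M) {v : Fin n → ℂ} (hv : ‖v‖ ≤ 1) :
    ‖blockGram A₀ I S k *ᵥ v‖ ≤ (Gamma A₀ I S π).toReal * π k := by
  have h1 : infNorm (blockGram A₀ I S k) / ENNReal.ofReal (π k) ≤ Gamma A₀ I S π :=
    (le_iSup (fun k => infNorm (blockGram A₀ I S k) / ENNReal.ofReal (π k)) k).trans
      (le_max_right _ _)
  rw [ENNReal.div_le_iff_le_mul (Or.inr hfin)
    (Or.inr (one_pos.trans_le hΓ).ne')] at h1
  have h2 : ‖blockGram A₀ I S k *ᵥ v‖ₑ ≤ Gamma A₀ I S π * ENNReal.ofReal (π k) :=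
    (le_iSup₂ (f := fun (v : Fin n → ℂ) (_ : ‖v‖ ≤ 1) => ‖blockGram A₀ I S k *ᵥ v‖ₑ) v hv).trans h1
  have h3 := ENNReal.toReal_mono (ENNReal.mul_ne_top hfin ENNReal.ofReal_ne_top) h2
  rwa [ENNReal.toReal_mul, ENNReal.toReal_ofReal (hπ.1 k), toReal_enorm] at h3

lemma proj_mulVec {v : Fin n → ℂ} (hv : ∀ i, i ∉ S → v i = 0) : proj S *ᵥ v = v := by
  ext i
  rw [proj, Matrix.mulVec_diagonal]
  by_cases hi : i ∈ S <;> simp [hi, hv i]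

lemma sum_blockGram_mulVec (hA₀ : A₀ ∈ Matrix.unitaryGroup (Fin n) ℂ)
    (hI_disj : Pairwise fun k l => Disjoint (I k) (I l))
    (hI_cover : ∀ i : Fin n, ∃ k : Fin M, i ∈ I k)
    {v : Fin n → ℂ} (hv : ∀ i, i ∉ S → v i = 0) (i : Fin n) :
    ∑ k, (blockGram A₀ I S k *ᵥ v) i = v i := by
  have hterm : ∀ k, (blockGram A₀ I S k *ᵥ v) i =
      ∑ r ∈ I k, star (A₀ r i) * (A₀ *ᵥ v) r := by
    intro k
    rw [blockGram, ← Matrix.mulVec_mulVec, ← Matrix.mulVec_mulVec, proj_mulVec hv,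
      ← Finset.sum_coe_sort]
    rfl
  have hunion : Finset.univ.biUnion I = (Finset.univ : Finset (Fin n)) := by
    ext r; simpa using hI_cover r
  simp only [hterm]
  rw [← Finset.sum_biUnion fun k _ l _ hkl => hI_disj hkl, hunion]
  change (A₀ᴴ *ᵥ (A₀ *ᵥ v)) i = v i
  rw [Matrix.mulVec_mulVec, ← Matrix.star_eq_conjTranspose, (Matrix.mem_unitaryGroup_iff').1 hA₀,
    Matrix.one_mulVec]

/-- The norm and variance estimates are the finite suprema `Θ` and `Υ`, extended from the unit ball
by homogeneity. -/
lemma isSampling_sampleGram (hA₀ : A₀ ∈ Matrix.unitaryGroup (Fin n) ℂ)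
    (hI_disj : Pairwise fun k l => Disjoint (I k) (I l))
    (hI_cover : ∀ i : Fin n, ∃ k : Fin M, i ∈ I k) (hπ : π ∈ stdSimplex ℝ (Fin M))
    (hΓ : 1 ≤ Gamma A₀ I S π) (hfin : Gamma A₀ I S π ≠ ∞) :
    IsSampling (sampleGram A₀ I S π) π S (Gamma A₀ I S π).toReal := by
  set g := (Gamma A₀ I S π).toReal with hg
  have hg1 : 1 ≤ g := by
    have := ENNReal.toReal_mono hfin hΓ
    rwa [ENNReal.toReal_one] at this
  have hunit : ∀ v : Fin n → ℂ, ∃ w : Fin n → ℂ, ‖w‖ ≤ 1 ∧ v = (‖v‖ : ℂ) • w := by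
    intro v
    by_cases hv : v = 0
    · exact ⟨0, by simp, by simp [hv]⟩
    · have hv' : (‖v‖ : ℂ) ≠ 0 := by exact_mod_cast norm_ne_zero_iff.2 hv
      refine ⟨(‖v‖ : ℂ)⁻¹ • v, ?_, by rw [smul_smul, mul_inv_cancel₀ hv', one_smul]⟩
      rw [norm_smul, norm_inv, Complex.norm_real, norm_norm]
      exact inv_mul_le_one
  refine ⟨hπ, hg1, ?_, ?_, ?_⟩
  · intro v hv i
    rw [← sum_blockGram_mulVec hA₀ hI_disj hI_cover hv i]
    refine Finset.sum_congr rfl fun k _ => ?_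
    rw [sampleGram_mulVec, Pi.smul_apply, smul_eq_mul]
    -- The inverse weight is `0` here, so the term survives only if the block itself kills `v`;
    -- finiteness of `Γ` forces this.
    by_cases hk : π k = 0
    · obtain ⟨w, hw, hvw⟩ := hunit v
      have h := norm_blockGram_mulVec_le hπ hΓ hfin k hw
      rw [hk, mul_zero, norm_le_zero_iff] at h
      have h0 : blockGram A₀ I S k *ᵥ v = 0 := by rw [hvw, Matrix.mulVec_smul, h, smul_zero]
      simp [h0]
    · rw [mul_inv_cancel_left₀ (by exact_mod_cast hk)]
  · intro k v i
    obtain ⟨w, hw, hvw⟩ := hunit v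
    have h := norm_blockGram_mulVec_le hπ hΓ hfin k hw
    have h1 : ‖(sampleGram A₀ I S π k *ᵥ w) i‖ ≤ g := by
      rw [sampleGram_mulVec]
      refine (norm_le_pi_norm _ i).trans ?_
      rw [norm_smul, norm_inv, Complex.norm_real, Real.norm_of_nonneg (hπ.1 k)]
      rcases (hπ.1 k).eq_or_lt with hk | hk
      · rw [← hk, inv_zero, zero_mul]; linarith
      · rw [inv_mul_le_iff₀ hk, mul_comm]; exact h
    rw [hvw, Matrix.mulVec_smul, Pi.smul_apply, norm_smul, ← hvw, Complex.norm_real, norm_norm,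
      mul_comm]
    exact mul_le_mul_of_nonneg_right h1 (norm_nonneg v)
  · intro v i
    obtain ⟨w, hw, hvw⟩ := hunit v
    have h : ∑ k, ‖(blockGram A₀ I S k *ᵥ w) i‖ₑ ^ 2 / ENNReal.ofReal (π k) ≤
        Gamma A₀ I S π :=
      ((le_iSup₂ (f := fun (v : Fin n → ℂ) (_ : ‖v‖ ≤ 1) =>
          ∑ k, ‖(blockGram A₀ I S k *ᵥ v) i‖ₑ ^ 2 / ENNReal.ofReal (π k)) w hw).trans
        (le_iSup (fun i => ⨆ (v : Fin n → ℂ) (_ : ‖v‖ ≤ 1),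
          ∑ k, ‖(blockGram A₀ I S k *ᵥ v) i‖ₑ ^ 2 / ENNReal.ofReal (π k)) i)).trans
        (le_max_left _ _)
    have hw' : ∑ k, π k * ‖(sampleGram A₀ I S π k *ᵥ w) i‖ ^ 2 ≤ g := by
      rw [hg, ← ENNReal.ofReal_le_iff_le_toReal hfin]
      rw [ENNReal.ofReal_sum_of_nonneg fun k _ => mul_nonneg (hπ.1 k) (sq_nonneg _)]
      refine (Finset.sum_le_sum fun k _ => ?_).trans h
      rcases (hπ.1 k).eq_or_lt with hk | hk
      · simp [← hk]
      · rw [sampleGram_mulVec, Pi.smul_apply, norm_smul, norm_inv, Complex.norm_real,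
          Real.norm_of_nonneg hk.le, ← ofReal_norm, ← ENNReal.ofReal_pow (norm_nonneg _),
          ← ENNReal.ofReal_div_of_pos hk]
        refine ENNReal.ofReal_le_ofReal (le_of_eq ?_)
        field_simp
    have hscale : ∀ k, π k * ‖(sampleGram A₀ I S π k *ᵥ v) i‖ ^ 2 =
        (π k * ‖(sampleGram A₀ I S π k *ᵥ w) i‖ ^ 2) * ‖v‖ ^ 2 := by
      intro k
      have : (sampleGram A₀ I S π k *ᵥ v) i = (‖v‖ : ℂ) * (sampleGram A₀ I S π k *ᵥ w) i := by
        conv_lhs => rw [hvw, Matrix.mulVec_smul, Pi.smul_apply, smul_eq_mul]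
      rw [this, norm_mul, Complex.norm_real, norm_norm]
      ring
    simp only [hscale]
    rw [← Finset.sum_mul]
    exact mul_le_mul_of_nonneg_right hw' (sq_nonneg _)

lemma star_dotProduct_sampleGram_mulVec {κ : Fin m → Fin M} {h : Fin n → ℂ}
    (hπ : π ∈ stdSimplex ℝ (Fin M)) (hh : sensingMatrix A₀ I π κ *ᵥ h = 0) (ℓ : Fin m)
    (w : Fin n → ℂ) : star h ⬝ᵥ (sampleGram A₀ I S π (κ ℓ) *ᵥ w) = 0 := by
  rw [sampleGram_mulVec, dotProduct_smul]
  rcases (hπ.1 (κ ℓ)).eq_or_lt with hk | hk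
  · simp [← hk]
  have hm : (0 : ℝ) < m := by exact_mod_cast ℓ.pos
  have hB : block A₀ I (κ ℓ) *ᵥ h = 0 := by
    ext i
    have hi := congrFun hh ⟨ℓ, i⟩
    simp only [Matrix.mulVec, dotProduct, sensingMatrix, mul_assoc, ← Finset.mul_sum,
      Pi.zero_apply] at hi
    refine (mul_eq_zero.1 hi).resolve_left ?_
    have : 0 < 1 / √(m : ℝ) * (1 / √(π (κ ℓ))) := by positivity
    exact_mod_cast this.ne'
  rw [blockGram, ← Matrix.mulVec_mulVec, Matrix.dotProduct_mulVec, ← Matrix.star_mulVec, hB]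
  simp

/-- The entrywise sign of a complex vector. -/
noncomputable def signVec (x : Fin n → ℂ) : Fin n → ℂ := fun i => x i / ‖x i‖

lemma norm_signVec_le (x : Fin n → ℂ) : ‖signVec x‖ ≤ 1 := by
  refine (pi_norm_le_iff_of_nonneg one_pos.le).2 fun i => ?_
  rw [signVec, norm_div, Complex.norm_real, norm_norm]
  exact div_self_le_one _

/-- Pair `x + h` with the unit number `x/‖x‖`: this is the subgradient inequality for the modulus.
At `x = 0` the sign is `0`. -/
lemma norm_add_re_sign_le (x h : ℂ) : ‖x‖ + (star h * (x / ‖x‖)).re ≤ ‖x + h‖ := by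
  by_cases hx : x = 0
  · simp [hx]
  have hx' : 0 < ‖x‖ := norm_pos_iff.2 hx
  have hxc : (‖x‖ : ℂ) ≠ 0 := by exact_mod_cast hx'.ne'
  have h1 : (star (x + h) * (x / ‖x‖)).re ≤ ‖x + h‖ := by
    refine (Complex.re_le_norm _).trans (le_of_eq ?_)
    rw [norm_mul, norm_star, norm_div, Complex.norm_real, norm_norm, div_self hx'.ne', mul_one]
  have h2 : star x * (x / ‖x‖) = (‖x‖ : ℂ) := by
    rw [← mul_div_assoc, Complex.star_def, ← Complex.normSq_eq_conj_mul_self,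
      Complex.normSq_eq_norm_sq]
    push_cast
    field_simp
  rw [star_add, add_mul, h2, Complex.add_re, Complex.ofReal_re] at h1
  exact h1

/-- The starting vectors of the golfing scheme: the sign of `x` and the basis vectors in `S`. -/
noncomputable def golfStart (S : Finset (Fin n)) (x : Fin n → ℂ) : Finset (Fin n → ℂ) := by
  classical
  exact insert (signVec x) (S.image fun i => Pi.single i 1)

lemma card_golfStart_le (S : Finset (Fin n)) (x : Fin n → ℂ) :
    (golfStart S x).card ≤ S.card + 1 := by
  classical
  exact (Finset.card_insert_le _ _).trans (Nat.add_le_add_right Finset.card_image_le 1)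

lemma golfStart_apply_of_notMem {x : Fin n → ℂ} (hx : ∀ i, i ∉ S → x i = 0) :
    ∀ v ∈ golfStart S x, ∀ i, i ∉ S → v i = 0 := by
  classical
  intro v hv i hi
  rw [golfStart, Finset.mem_insert, Finset.mem_image] at hv
  rcases hv with rfl | ⟨j, hj, rfl⟩
  · simp [signVec, hx i hi]
  · exact Pi.single_eq_of_ne (ne_of_mem_of_not_mem hj hi).symm 1

/-- If golfing succeeds from all starting vectors, then adding a nonzero vector in the kernel
increases the `ℓ¹` norm of `x`. -/
lemma l1Norm_lt_l1Norm_add {G : Fin M → Matrix (Fin n) (Fin n) ℂ} {p L : ℕ} {κ : Fin m → Fin M}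
    {x h : Fin n → ℂ} (hx : ∀ i, i ∉ S → x i = 0) (hL : (S.card : ℝ) * 0.48 ^ L ≤ 1 / 64)
    (hgood : ∀ v ∈ golfStart S x, GolfContracts G S p L κ v)
    (hker : ∀ ℓ w, star h ⬝ᵥ (G (κ ℓ) *ᵥ w) = 0) (hh : h ≠ 0) :
    l1Norm x < l1Norm (x + h) := by
  classical
  set a := ∑ i ∈ S, ‖h i‖ with ha
  set b := ∑ i ∈ Sᶜ, ‖h i‖ with hb
  have ha0 : 0 ≤ a := Finset.sum_nonneg fun i _ => norm_nonneg _
  have hb0 : 0 ≤ b := Finset.sum_nonneg fun i _ => norm_nonneg _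
  have hcert : ∀ v ∈ golfStart S x, ‖v‖ ≤ 1 →
      ‖star h ⬝ᵥ v‖ ≤ 0.48 ^ L * a + 12 / 13 * b := by
    intro v hv hv1
    refine (norm_star_dotProduct_le (golfStart_apply_of_notMem hx v hv) (hgood v hv) hker).trans ?_
    have h1 : (0.48 : ℝ) ^ L * ‖v‖ ≤ 0.48 ^ L := mul_le_of_le_one_right (by positivity) hv1
    have h2 : (12 / 13 : ℝ) * ‖v‖ ≤ 12 / 13 := mul_le_of_le_one_right (by positivity) hv1
    exact add_le_add (mul_le_mul_of_nonneg_right h1 ha0) (mul_le_mul_of_nonneg_right h2 hb0)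
  -- The certificate from the `i`-th basis vector bounds `‖h i‖`; summing over `S` costs a factor
  -- `S.card`.
  have hab : a ≤ S.card * (0.48 ^ L * a + 12 / 13 * b) := by
    rw [ha, ← nsmul_eq_mul]
    refine Finset.sum_le_card_nsmul _ _ _ fun i hi => ?_
    have hmem : (Pi.single i 1 : Fin n → ℂ) ∈ golfStart S x := by
      rw [golfStart]
      exact Finset.mem_insert_of_mem (Finset.mem_image_of_mem (fun i => Pi.single i 1) hi)
    have h1 := hcert _ hmem (by
      refine (pi_norm_le_iff_of_nonneg one_pos.le).2 fun j => ?_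
      by_cases hj : j = i
      · subst hj; simp
      · simp [Pi.single_eq_of_ne hj])
    simpa using h1
  have hsign := hcert (signVec x) (by rw [golfStart]; exact Finset.mem_insert_self _ _)
    (norm_signVec_le x)
  have hsum : (star h ⬝ᵥ signVec x).re = ∑ i ∈ S, (star (h i) * (x i / ‖x i‖)).re := by
    rw [dotProduct, Complex.re_sum]
    refine (Finset.sum_subset (Finset.subset_univ S) fun i _ hi => ?_).symm
    simp [signVec, hx i hi]
  have hxnorm : l1Norm x = ∑ i ∈ S, ‖x i‖ := by
    refine (Finset.sum_subset (Finset.subset_univ S) fun i _ hi => ?_).symm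
    simp [hx i hi]
  have hadd : l1Norm x - ‖star h ⬝ᵥ signVec x‖ + b ≤ l1Norm (x + h) := by
    have e : l1Norm (x + h) = ∑ i ∈ S, ‖x i + h i‖ + b := by
      rw [l1Norm, ← Finset.sum_add_sum_compl S, hb]
      congr 1
      refine Finset.sum_congr rfl fun i hi => ?_
      rw [Pi.add_apply, hx i (Finset.mem_compl.1 hi), zero_add]
    have h1 : l1Norm x + (star h ⬝ᵥ signVec x).re ≤ ∑ i ∈ S, ‖x i + h i‖ := by
      rw [hxnorm, hsum, ← Finset.sum_add_distrib]
      exact Finset.sum_le_sum fun i _ => norm_add_re_sign_le (x i) (h i)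
    have h2 := (abs_le.1 (Complex.abs_re_le_norm (star h ⬝ᵥ signVec x))).1
    linarith
  have hq : (0 : ℝ) < 0.48 ^ L := by positivity
  have hs0 : (0 : ℝ) ≤ S.card := Nat.cast_nonneg _
  have h63 : 63 * a ≤ 64 * (S.card * (12 / 13 * b)) := by
    have := mul_le_mul_of_nonneg_right hL ha0
    nlinarith
  -- The factor `0.48 ^ L` cancels `S.card`. The total is then `(64/63)(12/13) b < b`, which leaves
  -- room for strictness.
  have hqa : 0.48 ^ L * a ≤ 1 / 63 * (12 / 13 * b) := by
    have h1 := mul_le_mul_of_nonneg_left h63 hq.le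
    have h2 := mul_le_mul_of_nonneg_right hL hb0
    nlinarith
  have hbpos : 0 < b := by
    refine hb0.lt_of_ne fun h0 => hh ?_
    have ha' : a = 0 := by
      rw [← h0] at h63
      linarith
    ext i
    rw [Pi.zero_apply, ← norm_eq_zero]
    by_cases hi : i ∈ S
    · exact (Finset.sum_eq_zero_iff_of_nonneg fun i _ => norm_nonneg _).1 ha' i hi
    · exact (Finset.sum_eq_zero_iff_of_nonneg fun i _ => norm_nonneg _).1 h0.symm i
        (Finset.mem_compl.2 hi)
  linarith

lemma isUniqueL1Minimizer_of_lt {ι : Type*} {A : Matrix ι (Fin n) ℂ}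
    {x : Fin n → ℂ} (h : ∀ h, A *ᵥ h = 0 → h ≠ 0 → l1Norm x < l1Norm (x + h)) :
    IsUniqueL1Minimizer A (A *ᵥ x) x := by
  have hlt : ∀ w, A *ᵥ w = A *ᵥ x → w ≠ x → l1Norm x < l1Norm w := by
    intro w hw hne
    have := h (w - x) (by rw [Matrix.mulVec_sub, hw, sub_self]) (sub_ne_zero.2 hne)
    rwa [add_sub_cancel] at this
  refine ⟨⟨rfl, fun w hw => ?_⟩, fun z hz => ?_⟩
  · by_cases hne : w = x
    · rw [hne]
    · exact (hlt w hw hne).le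
  · by_contra hne
    exact (hlt z hz.1 hne).not_ge (hz.2 x rfl)

end Recovery

/-! ### Choice of parameters and numerical constants. -/

lemma log_forty_eight_le : Real.log 0.48 ≤ -0.7 := by
  have h1 : (0.48 : ℝ) = 2⁻¹ * 0.96 := by norm_num
  have h2 := Real.log_le_sub_one_of_pos (by norm_num : (0 : ℝ) < 0.96)
  have h3 := Real.log_two_gt_d9
  rw [h1, Real.log_mul (by norm_num) (by norm_num), Real.log_inv]
  norm_num at *
  linarith

lemma log_sixty_four_mul_ge {s : ℕ} (hs : 16 ≤ s) : 6.9 ≤ Real.log (64 * s) := by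
  have h : (2 : ℝ) ^ 10 ≤ 64 * s := by
    have : (16 : ℝ) ≤ s := by exact_mod_cast hs
    linarith
  have h1 := Real.log_le_log (by positivity) h
  rw [Real.log_pow] at h1
  have h3 := Real.log_two_gt_d9
  norm_num at *
  linarith

lemma one_le_log_log {s : ℕ} (hs : 16 ≤ s) : 1 ≤ Real.log (Real.log (64 * s)) := by
  have h := log_sixty_four_mul_ge hs
  rw [Real.le_log_iff_exp_le (by linarith)]
  have := Real.exp_one_lt_d9
  linarith

lemma log_nine_mul_div_nonneg {n : ℕ} (hn : 1 ≤ n) {ε : ℝ} (hε : ε ∈ Set.Ioo (0 : ℝ) 1) :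
    0 ≤ Real.log (9 * n / ε) := by
  refine Real.log_nonneg ?_
  rw [le_div_iff₀ hε.1]
  have : (1 : ℝ) ≤ n := by exact_mod_cast hn
  linarith [hε.2]

/-- The number `L` of golfing steps and the number `p` of draws per step. -/
lemma exists_golf_parameters {n m s : ℕ} (hs : 16 ≤ s) (hn : s ≤ n) {ε : ℝ}
    (hε : ε ∈ Set.Ioo (0 : ℝ) 1) {g : ℝ} (hg : 1 ≤ g)
    (hm : 73 * g * (Real.log (64 * s) * (Real.log (9 * n / ε) + Real.log (Real.log (64 * s)))) ≤
      m) :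
    ∃ L p : ℕ, 0 < p ∧ L * p ≤ m ∧ (s : ℝ) * 0.48 ^ L ≤ 1 / 64 ∧
      (s + 1 : ℝ) * (L * (n * (4 * Real.exp (-(0.0465 * p / g))))) < ε := by
  have hℓ := log_sixty_four_mul_ge hs
  have hR1 := one_le_log_log hs
  have hR0 := log_nine_mul_div_nonneg (by omega : 1 ≤ n) hε
  have hsr : (16 : ℝ) ≤ s := by exact_mod_cast hs
  have hnr : (s : ℝ) ≤ n := by exact_mod_cast hn
  have hε0 := hε.1
  have hexpR : Real.exp (Real.log (9 * n / ε) + Real.log (Real.log (64 * s))) =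
      9 * n / ε * Real.log (64 * s) := by
    rw [Real.exp_add, Real.exp_log (by have : (0 : ℝ) < n := by linarith
                                       positivity), Real.exp_log (by linarith)]
  set ℓ := Real.log (64 * s) with hℓdef
  set R := Real.log (9 * n / ε) + Real.log ℓ with hR
  have hR' : 1 ≤ R := by linarith
  -- As `log 0.48 ≤ -0.7`, this gives `0.48^L ≤ 1/(64s)`. Rounding up costs little since `ℓ ≥ 6.9`,
  -- whence `1.58`.
  set L := ⌈ℓ / 0.7⌉₊ with hLdef
  have hLge : ℓ / 0.7 ≤ L := Nat.le_ceil _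
  have hLle : (L : ℝ) ≤ 1.58 * ℓ := by
    have := Nat.ceil_lt_add_one (by positivity : 0 ≤ ℓ / 0.7)
    rw [← hLdef, div_eq_mul_inv] at this
    norm_num at *
    linarith
  have hLge' : ℓ ≤ 0.7 * L := by
    rw [div_le_iff₀ (by norm_num)] at hLge; linarith
  have hL0 : 0 < L := by
    have : (0 : ℝ) < L := by linarith
    exact_mod_cast this
  have hL0r : (0 : ℝ) < L := by exact_mod_cast hL0
  have hpm : (m : ℝ) < L * (m / L : ℕ) + L := by
    have := Nat.lt_mul_div_succ m hL0
    rw [mul_add, mul_one] at this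
    exact_mod_cast this
  set p := m / L with hp
  have hgR : 1 ≤ g * R := one_le_mul_of_one_le_of_one_le hg hR'
  -- `73/1.58 > 46.2`; the `1` is the loss from rounding `m / L` down.
  have hpge : 46.2 * (g * R) ≤ p + 1 := by
    refine le_of_mul_le_mul_left ?_ hL0r
    have h1 : (L : ℝ) * (46.2 * (g * R)) ≤ 1.58 * ℓ * (46.2 * (g * R)) :=
      mul_le_mul_of_nonneg_right hLle (by linarith)
    have h2 : 0 ≤ ℓ * (g * R) := by
      apply mul_nonneg <;> linarith
    linarith
  refine ⟨L, p, ?_, ?_, ?_, ?_⟩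
  · have : (0 : ℝ) < p := by linarith
    exact_mod_cast this
  · exact Nat.mul_div_le m L
  · have h1 : (0.48 : ℝ) ^ L ≤ Real.exp (-ℓ) := by
      rw [← Real.exp_log (by norm_num : (0 : ℝ) < 0.48), ← Real.exp_nat_mul]
      refine Real.exp_le_exp.2 ?_
      have := mul_le_mul_of_nonneg_left log_forty_eight_le hL0r.le
      linarith
    rw [Real.exp_neg, hℓdef, Real.exp_log (by positivity)] at h1
    refine (mul_le_mul_of_nonneg_left h1 (by positivity)).trans (le_of_eq ?_)
    field_simp
  · have hexp : Real.exp (-(0.0465 * p / g)) ≤ (ε / (9 * n * ℓ)) ^ 2 := by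
      have h1 : 2 * R ≤ 0.0465 * p / g := by
        rw [le_div_iff₀ (by linarith)]
        nlinarith
      calc Real.exp (-(0.0465 * p / g)) ≤ Real.exp (-(2 * R)) := Real.exp_le_exp.2 (by linarith)
        _ = (Real.exp R)⁻¹ ^ 2 := by
          rw [← Real.exp_neg, ← Real.exp_nat_mul]; congr 1; push_cast; ring
        _ = _ := by
          rw [hexpR, div_mul_eq_mul_div, inv_div]
    have hn0 : (0 : ℝ) < n := by linarith
    have hℓ0 : 0 < ℓ := by linarith
    calc (s + 1 : ℝ) * (L * (n * (4 * Real.exp (-(0.0465 * p / g)))))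
        ≤ (2 * n) * ((1.58 * ℓ) * (n * (4 * (ε / (9 * n * ℓ)) ^ 2))) := by
          gcongr
          linarith
      _ = ε * (12.64 / 81 * (ε / ℓ)) := by field_simp; norm_num
      _ < ε * 1 := by
          refine mul_lt_mul_of_pos_left ?_ hε0
          have : ε / ℓ < 1 := (div_lt_one hℓ0).2 (by linarith [hε.2])
          norm_num
          linarith
      _ = ε := mul_one ε

end BlockCS

/-! ### The recovery theorem. -/

theorem theorem1 {n M m s : ℕ}
    (A₀ : Matrix (Fin n) (Fin n) ℂ) (hA₀ : A₀ ∈ Matrix.unitaryGroup (Fin n) ℂ)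
    (I : Fin M → Finset (Fin n))
    (hI_disj : Pairwise fun k l => Disjoint (I k) (I l))
    (hI_cover : ∀ i : Fin n, ∃ k : Fin M, i ∈ I k)
    (π : Fin M → ℝ) (hπ : π ∈ stdSimplex ℝ (Fin M))
    (S : Finset (Fin n)) (hS : S.card = s) (hs : 16 ≤ s)
    (x : Fin n → ℂ) (hx : ∀ i, i ∉ S → x i = 0)
    (ε : ℝ) (hε : ε ∈ Set.Ioo (0 : ℝ) 1)
    {Ω : Type*} [MeasurableSpace Ω] (P : Measure Ω) [IsProbabilityMeasure P]
    (K : Fin m → Ω → Fin M) (hK_meas : ∀ ℓ, Measurable (K ℓ))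
    (hK_indep : iIndepFun K P)
    (hK_law : ∀ ℓ k, P.real {ω | K ℓ ω = k} = π k)
    (hΓ : 1 ≤ BlockCS.Gamma A₀ I S π)
    (hm : 73 * BlockCS.Gamma A₀ I S π *
        ENNReal.ofReal (Real.log (64 * s) * (Real.log (9 * n / ε) + Real.log (Real.log (64 * s))))
      ≤ (m : ℝ≥0∞)) :
    1 - ε < P.real {ω |
      BlockCS.IsUniqueL1Minimizer (BlockCS.sensingMatrix A₀ I π fun ℓ => K ℓ ω)
        ((BlockCS.sensingMatrix A₀ I π fun ℓ => K ℓ ω) *ᵥ x) x} := by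
  have hn : s ≤ n := by
    rw [← hS]; simpa using S.card_le_univ
  have hlog : 0 < Real.log (64 * s) *
      (Real.log (9 * n / ε) + Real.log (Real.log (64 * s))) := by
    have h1 := BlockCS.log_sixty_four_mul_ge hs
    have h2 := BlockCS.one_le_log_log hs
    have h3 := BlockCS.log_nine_mul_div_nonneg (by omega : 1 ≤ n) hε
    exact mul_pos (by linarith) (by linarith)
  -- The logarithmic factor is positive, so an infinite `Γ` would force `m = ∞`.
  have hfin : BlockCS.Gamma A₀ I S π ≠ ∞ := by
    intro htop
    rw [htop, ENNReal.mul_top (by norm_num),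
      ENNReal.top_mul (by simpa using hlog), top_le_iff] at hm
    exact ENNReal.natCast_ne_top m hm
  have hsamp := BlockCS.isSampling_sampleGram hA₀ hI_disj hI_cover hπ hΓ hfin
  have hm' := ENNReal.toReal_mono (ENNReal.natCast_ne_top m) hm
  rw [ENNReal.toReal_mul, ENNReal.toReal_mul, ENNReal.toReal_ofReal hlog.le,
    ENNReal.toReal_natCast, ENNReal.toReal_ofNat] at hm'
  obtain ⟨L, p, hp, hLp, hL, hfail⟩ := BlockCS.exists_golf_parameters hs hn hε hsamp.one_le hm'
  have hbad := hsamp.mass_not_golfContracts_le hp hLp (BlockCS.golfStart S x)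
    (BlockCS.golfStart_apply_of_notMem hx)
  rw [BlockCS.measureReal_eq_mass P K hK_meas hK_indep hK_law fun κ =>
    BlockCS.IsUniqueL1Minimizer (BlockCS.sensingMatrix A₀ I π κ)
      (BlockCS.sensingMatrix A₀ I π κ *ᵥ x) x]
  set E : (Fin m → Fin M) → Prop := fun κ =>
    ∃ v ∈ BlockCS.golfStart S x, ¬ BlockCS.GolfContracts (BlockCS.sampleGram A₀ I S π) S p L κ v
  have hcard : ((BlockCS.golfStart S x).card : ℝ) ≤ s + 1 := by
    rw [← hS]; exact_mod_cast BlockCS.card_golfStart_le S x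
  have hE : BlockCS.mass π E < ε := by
    refine (hbad.trans ?_).trans_lt hfail
    exact mul_le_mul_of_nonneg_right hcard (by positivity)
  have hnot := BlockCS.mass_add_mass_not hπ E
  refine (by linarith : 1 - ε < BlockCS.mass π fun κ => ¬ E κ).trans_le
    (BlockCS.mass_mono hπ fun κ hκ => ?_)
  refine BlockCS.isUniqueL1Minimizer_of_lt fun h hh hne => ?_
  have hgood : ∀ v ∈ BlockCS.golfStart S x,
      BlockCS.GolfContracts (BlockCS.sampleGram A₀ I S π) S p L κ v := fun v hv => by
    by_contra hcon
    exact hκ ⟨v, hv, hcon⟩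
  exact BlockCS.l1Norm_lt_l1Norm_add hx (hS.symm ▸ hL) hgood
    (BlockCS.star_dotProduct_sampleGram_mulVec hπ hh) hne
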